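/- Let $n$ and $d$ be integers with $0\le d\le n-1$ and $n+d$ odd. A rectilinear drawing of a finite simple graph $G$ represents its vertices by distinct points of the plane and each edge by the straight line segment joining its two endpoints, such that no edge passes through a vertex other than its endpoints and any two distinct edges have at most one point in common, which is either a vertex point or a crossing; here a crossing is a point, not a vertex point, that lies on exactly two edges. Let $\overline{\rm CR}(G)$ denote the maximum number of crossings over all rectilinear drawings of $G$, and let $\overline{\rm CR}(R_{n,d})$ denote the maximum of $\overline{\rm CR}(G)$ over the class $R_{n,d}$ of all $d$-regular simple graphs $G$ on $n$ vertices. Then all these maxima exist, and $$\overline{\rm CR}(R_{n,d})=\frac{1}{24}\,nd\,\bigl(3nd-2d^2-6d+2\bigr).$$ -/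

import Mathlib

/-- The Euclidean plane. -/
abbrev Plane : Type := EuclideanSpace ℝ (Fin 2)

/-- The closed straight line segment that represents the edge `e` when each vertex `v` is
placed at the point `pos v`. -/
def edgeSegment {V : Type*} (pos : V → Plane) (e : Sym2 V) : Set Plane :=
  Sym2.lift ⟨fun u v => segment ℝ (pos u) (pos v), fun u v => segment_symm ℝ (pos u) (pos v)⟩ e

/-- A crossing: a point, not a vertexpoint, at which exactly two edges intersect. -/
def IsCrossing {V : Type*} (G : SimpleGraph V) (pos : V → Plane) (p : Plane) : Prop :=
  p ∉ Set.range pos ∧ {e : Sym2 V | e ∈ G.edgeSet ∧ p ∈ edgeSegment pos e}.ncard = 2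

/-- A rectilinear drawing of `G`: vertices are distinct points of the plane, edges are straight
line segments which contain no vertexpoints besides their endpoints, and two distinct edges have
at most one point in common, which is either a vertexpoint or a crossing. -/
structure RectilinearDrawing {V : Type*} (G : SimpleGraph V) where
  pos : V → Plane
  pos_injective : Function.Injective pos
  vertex_on_edge : ∀ e ∈ G.edgeSet, ∀ v : V, pos v ∈ edgeSegment pos e → v ∈ e
  inter_subsingleton : ∀ e ∈ G.edgeSet, ∀ f ∈ G.edgeSet, e ≠ f →
    (edgeSegment pos e ∩ edgeSegment pos f).Subsingleton
  inter_vertex_or_crossing : ∀ e ∈ G.edgeSet, ∀ f ∈ G.edgeSet, e ≠ f →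
    ∀ p ∈ edgeSegment pos e ∩ edgeSegment pos f, p ∈ Set.range pos ∨ IsCrossing G pos p

/-- The number of crossings of a rectilinear drawing. -/
noncomputable def RectilinearDrawing.numCrossings {V : Type*} {G : SimpleGraph V}
    (D : RectilinearDrawing G) : ℕ :=
  {p : Plane | IsCrossing G D.pos p}.ncard

/-- The set of all numbers of crossings of rectilinear drawings of `G`. -/
def rectilinearCrossingCounts {V : Type*} (G : SimpleGraph V) : Set ℕ :=
  Set.range fun D : RectilinearDrawing G => D.numCrossings

/-- The maximum rectilinear crossing number of `G`. -/
noncomputable def maxRectilinearCrossingNumber {V : Type*} (G : SimpleGraph V) : ℕ :=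
  sSup (rectilinearCrossingCounts G)

open Classical in
/-- The class of `d`-regular graphs of order `n` (represented on the vertex set `Fin n`). -/
def regularGraphs (n d : ℕ) : Set (SimpleGraph (Fin n)) :=
  {G | G.IsRegularOfDegree d}

/-- The maximum of the maximum rectilinear crossing numbers of all `d`-regular graphs of
order `n`. -/
noncomputable def maxRectilinearCrossingNumberRegular (n d : ℕ) : ℕ :=
  sSup (maxRectilinearCrossingNumber '' regularGraphs n d)

/-! Count crossings as ordered quadruples (a, b, c, e) with ab and ce edges that cross properly.
Each crossing accounts for eight quadruples, so X = 8·cr. Let T = nd(nd − 4d + 2) be the number of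
quadruples in which ab and ce are edges without a common endpoint. The theorem says that the least
possible value of T − X is (2/3)·nd(d − 1)(d − 2).

Upper bound on X. A small perturbation keeps all proper crossings and makes every three vertices
non-collinear (`exists_general_position`). Let W be the number of quadruples in which the line bc
separates a from e. For two disjoint edges, consider the four lines joining an end of one to an end
of the other. If the edges cross, none of these lines separates the two remaining ends; otherwise at
most two do. Averaging over the labellings gives 2W ≤ T − X (`two_mul_sum_separated_le`).

For a lower bound on W, keep only the lines through adjacent u and v. With l neighbours of u to the
left of uv and r to the right, and l', r' the same for v as seen from v, one has l + r = l' + r' = d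
− 1. Hence ll' + rr' − lr − l'r' = (l + l' − d + 1)² ≥ 0. So W is at least the number of (u, v, a,
b) with v, a, b neighbours of u and the line uv separating a from b (`sum_two_sided_le`). Among any
three neighbours of u, at least one lies on a line through u separating the other two, so this
number is at least nd(d − 1)(d − 2)/3 (`three_mul_sum_separated`).

Sharpness. Place the vertices in convex position and join those at cyclic distance at least s = (n +
1 − d)/2. Two disjoint edges that do not cross can be labelled so that a, b, c, e is their cyclic
order. For each a, such labellings inject into the 3-subsets of a d-set (`sum_cyclicOrder_le`), so T
− X ≤ 4n·C(d, 3), the same value. Generic abscissae on a parabola make this convex placement a legal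
drawing. -/

/-! ### Segments in the plane and orientations -/

/-- Twice the signed area of the triangle `p q r`. -/
def orient (p q r : Plane) : ℝ :=
  (q 0 - p 0) * (r 1 - p 1) - (q 1 - p 1) * (r 0 - p 0)

/-- The segments `ab` and `cd` cross properly, expressed through orientations. -/
def ProperCross {V : Type*} (pos : V → Plane) (a b c d : V) : Prop :=
  orient (pos a) (pos b) (pos c) * orient (pos a) (pos b) (pos d) < 0 ∧
    orient (pos c) (pos d) (pos a) * orient (pos c) (pos d) (pos b) < 0

theorem plane_ext {p q : Plane} (h0 : p 0 = q 0) (h1 : p 1 = q 1) : p = q := by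
  ext i
  fin_cases i
  · exact h0
  · exact h1

theorem mem_segment_plane {a b p : Plane} :
    p ∈ segment ℝ a b ↔ ∃ θ : ℝ, 0 ≤ θ ∧ θ ≤ 1 ∧
      p 0 = (1 - θ) * a 0 + θ * b 0 ∧ p 1 = (1 - θ) * a 1 + θ * b 1 := by
  rw [segment_eq_image]
  constructor
  · rintro ⟨θ, ⟨h0, h1⟩, rfl⟩
    exact ⟨θ, h0, h1, by simp, by simp⟩
  · rintro ⟨θ, h0, h1, e0, e1⟩
    exact ⟨θ, ⟨h0, h1⟩, plane_ext (by simp [e0]) (by simp [e1])⟩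

theorem exists_mem_segment_of_orient {a b c d : Plane}
    (h1 : orient a b c * orient a b d < 0) (h2 : orient c d a * orient c d b < 0) :
    ∃ p, p ∈ segment ℝ a b ∩ segment ℝ c d := by
  have key : ∀ {x y : ℝ}, x * y < 0 → x - y ≠ 0 ∧ 0 ≤ x / (x - y) ∧ x / (x - y) ≤ 1 := by
    intro x y h
    rcases mul_neg_iff.1 h with ⟨hx, hy⟩ | ⟨hx, hy⟩
    · have : 0 < x - y := by linarith
      exact ⟨this.ne', by positivity, (div_le_one this).2 (by linarith)⟩
    · have : x - y < 0 := by linarith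
      exact ⟨this.ne, div_nonneg_of_nonpos hx.le this.le, (div_le_one_of_neg this).2 (by linarith)⟩
  obtain ⟨n1, l1, u1⟩ := key h1
  obtain ⟨n2, l2, u2⟩ := key h2
  -- An affine function with values x and y at the ends of a segment vanishes at parameter x / (x −
  -- y). Here this is applied to the orientation with respect to the line of the other segment.
  set θ := orient c d a / (orient c d a - orient c d b) with hθ
  set η := orient a b c / (orient a b c - orient a b d) with hη
  refine ⟨!₂[(1 - θ) * a 0 + θ * b 0, (1 - θ) * a 1 + θ * b 1],
    mem_segment_plane.2 ⟨θ, l2, u2, by simp, by simp⟩,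
    mem_segment_plane.2 ⟨η, l1, u1, ?_, ?_⟩⟩
  · simp only [Matrix.cons_val_zero]
    rw [hθ, hη]
    field_simp
    simp only [orient]
    ring
  · simp only [Matrix.cons_val_one, Matrix.cons_val_zero]
    rw [hθ, hη]
    field_simp
    simp only [orient]
    ring

-- Two parallel segments that meet at a point interior to both lie on one line and overlap near that
-- point. Since edges of a drawing share at most one point, this excludes parallel edges at a
-- crossing.
open Filter Topology in
theorem exists_second_common_point {a b c d p : Plane} (hab : a ≠ b) (hcd : c ≠ d)
    (h1 : p ∈ segment ℝ a b) (h2 : p ∈ segment ℝ c d)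
    (hpa : p ≠ a) (hpb : p ≠ b) (hpc : p ≠ c) (hpd : p ≠ d)
    (hpar : (b 0 - a 0) * (d 1 - c 1) = (b 1 - a 1) * (d 0 - c 0)) :
    ∃ q ∈ segment ℝ a b ∩ segment ℝ c d, q ≠ p := by
  have key : ∀ {a b p : Plane}, p ∈ segment ℝ a b → p ≠ a → p ≠ b → ∃ θ : ℝ, 0 < θ ∧ θ < 1 ∧
      p 0 = (1 - θ) * a 0 + θ * b 0 ∧ p 1 = (1 - θ) * a 1 + θ * b 1 := by
    intro a b p h ha hb
    obtain ⟨θ, l, u, e0, e1⟩ := mem_segment_plane.1 h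
    refine ⟨θ, lt_of_le_of_ne l ?_, lt_of_le_of_ne u ?_, e0, e1⟩
    · rintro rfl
      exact ha (plane_ext (by simp [e0]) (by simp [e1]))
    · rintro rfl
      exact hb (plane_ext (by simp [e0]) (by simp [e1]))
  obtain ⟨θ, l1, u1, e0, e1⟩ := key h1 hpa hpb
  obtain ⟨η, l2, u2, f0, f1⟩ := key h2 hpc hpd
  have hn : (b 0 - a 0) ^ 2 + (b 1 - a 1) ^ 2 ≠ 0 := by
    intro h
    exact hab (plane_ext (by nlinarith [sq_nonneg (b 0 - a 0), sq_nonneg (b 1 - a 1)])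
      (by nlinarith [sq_nonneg (b 0 - a 0), sq_nonneg (b 1 - a 1)]))
  obtain ⟨μ, g0, g1⟩ : ∃ μ : ℝ, d 0 - c 0 = μ * (b 0 - a 0) ∧ d 1 - c 1 = μ * (b 1 - a 1) := by
    refine ⟨((d 0 - c 0) * (b 0 - a 0) + (d 1 - c 1) * (b 1 - a 1)) /
      ((b 0 - a 0) ^ 2 + (b 1 - a 1) ^ 2), ?_, ?_⟩
    · field_simp
      linear_combination (-(b 1 - a 1)) * hpar
    · field_simp
      linear_combination (b 0 - a 0) * hpar
  have hev : ∀ᶠ ε : ℝ in 𝓝 0, (0 < θ + ε * μ ∧ θ + ε * μ < 1) ∧ (0 < η + ε ∧ η + ε < 1) := by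
    have c1 : Tendsto (fun ε : ℝ => θ + ε * μ) (𝓝 0) (𝓝 θ) := by
      have : Continuous fun ε : ℝ => θ + ε * μ := by fun_prop
      simpa using this.tendsto 0
    have c2 : Tendsto (fun ε : ℝ => η + ε) (𝓝 0) (𝓝 η) := by
      have : Continuous fun ε : ℝ => η + ε := by fun_prop
      simpa using this.tendsto 0
    exact ((c1.eventually_const_lt l1).and (c1.eventually_lt_const u1)).and
      ((c2.eventually_const_lt l2).and (c2.eventually_lt_const u2))
  obtain ⟨ε, ⟨⟨k1, k2⟩, k3, k4⟩, hε⟩ :=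
    ((hev.filter_mono nhdsWithin_le_nhds).and (self_mem_nhdsWithin (s := {(0 : ℝ)}ᶜ))).exists
  have hε : ε ≠ 0 := hε
  refine ⟨!₂[p 0 + ε * (d 0 - c 0), p 1 + ε * (d 1 - c 1)],
    ⟨mem_segment_plane.2 ⟨θ + ε * μ, k1.le, k2.le, ?_, ?_⟩,
      mem_segment_plane.2 ⟨η + ε, k3.le, k4.le, ?_, ?_⟩⟩, ?_⟩
  · simp; linear_combination e0 + ε * g0
  · simp; linear_combination e1 + ε * g1
  · simp; linear_combination f0
  · simp; linear_combination f1
  · intro h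
    have q0 := congrArg (fun x : Plane => x 0) h
    have q1 := congrArg (fun x : Plane => x 1) h
    simp [hε] at q0 q1
    exact hcd (plane_ext (by linarith) (by linarith))

/-- The function `orient a b` is affine and vanishes at p, which is a strict convex combination of c
and d. Its values at c and d therefore have opposite signs, unless both are zero, which
non-parallelism forbids. -/
theorem orient_mul_neg_of_mem_segment {a b c d p : Plane} (h1 : p ∈ segment ℝ a b)
    (h2 : p ∈ segment ℝ c d) (hpc : p ≠ c) (hpd : p ≠ d)
    (hpar : (b 0 - a 0) * (d 1 - c 1) ≠ (b 1 - a 1) * (d 0 - c 0)) :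
    orient a b c * orient a b d < 0 := by
  obtain ⟨θ, -, -, e0, e1⟩ := mem_segment_plane.1 h1
  obtain ⟨η, l, u, f0, f1⟩ := mem_segment_plane.1 h2
  have l' : 0 < η := lt_of_le_of_ne l (by
    rintro rfl; exact hpc (plane_ext (by simp [f0]) (by simp [f1])))
  have u' : η < 1 := lt_of_le_of_ne u (by
    rintro rfl; exact hpd (plane_ext (by simp [f0]) (by simp [f1])))
  have h : (1 - η) * orient a b c + η * orient a b d = 0 := by
    have : orient a b p = 0 := by simp only [orient, e0, e1]; ring
    simp only [orient, f0, f1] at this ⊢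
    linear_combination this
  have hne : orient a b c ≠ orient a b d := by
    intro h'
    apply hpar
    simp only [orient] at h'
    linarith
  have hc : orient a b c ≠ 0 := by
    intro h0
    rw [h0] at h hne
    simp [l'.ne'] at h
    exact hne h.symm
  have : 0 < η * -(orient a b c * orient a b d) := by
    have : η * -(orient a b c * orient a b d) = (1 - η) * (orient a b c) ^ 2 := by
      linear_combination (-orient a b c) * h
    rw [this]
    have : 0 < 1 - η := by linarith
    positivity
  have := pos_of_mul_pos_right this l'.le
  linarith

theorem ProperCross.ne {V : Type*} {pos : V → Plane} {a b c d : V} (h : ProperCross pos a b c d) :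
    a ≠ c ∧ a ≠ d ∧ b ≠ c ∧ b ≠ d := by
  refine ⟨?_, ?_, ?_, ?_⟩ <;> rintro rfl <;>
  · have := h.1
    simp [orient, mul_comm] at this

theorem ProperCross.sym2_ne {V : Type*} {pos : V → Plane} {a b c d : V}
    (h : ProperCross pos a b c d) : s(a, b) ≠ s(c, d) := by
  obtain ⟨n1, n2, -, -⟩ := h.ne
  simp [n1, n2]

theorem ProperCross.swap {V : Type*} {pos : V → Plane} {a b c d : V}
    (h : ProperCross pos a b c d) : ProperCross pos b a c d := by
  simp only [ProperCross, orient] at *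
  constructor <;> nlinarith [h.1, h.2]

theorem ProperCross.symm {V : Type*} {pos : V → Plane} {a b c d : V}
    (h : ProperCross pos a b c d) : ProperCross pos c d a b := ⟨h.2, h.1⟩

/-! ### Crossings of a drawing as quadruples of vertices -/

namespace RectilinearDrawing

variable {V : Type*} {G : SimpleGraph V} (D : RectilinearDrawing G)

theorem isCrossing_of_properCross {a b c d : V} (hab : G.Adj a b) (hcd : G.Adj c d)
    (h : ProperCross D.pos a b c d) :
    ∃ p, IsCrossing G D.pos p ∧ p ∈ edgeSegment D.pos s(a, b) ∩ edgeSegment D.pos s(c, d) := by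
  obtain ⟨p, hp⟩ := exists_mem_segment_of_orient h.1 h.2
  obtain ⟨n1, n2, n3, n4⟩ := h.ne
  refine ⟨p, ?_, hp⟩
  rcases D.inter_vertex_or_crossing s(a, b) hab s(c, d) hcd h.sym2_ne p hp with
    ⟨v, rfl⟩ | h'
  · have h1 := D.vertex_on_edge s(a, b) hab v hp.1
    have h2 := D.vertex_on_edge s(c, d) hcd v hp.2
    simp only [Sym2.mem_iff] at h1 h2
    rcases h1 with rfl | rfl <;> rcases h2 with rfl | rfl <;> contradiction
  · exact h'

theorem properCross_of_mem {a b c d : V} (hab : G.Adj a b) (hcd : G.Adj c d)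
    (hne : s(a, b) ≠ s(c, d)) {p : Plane} (hp : p ∉ Set.range D.pos)
    (h1 : p ∈ edgeSegment D.pos s(a, b)) (h2 : p ∈ edgeSegment D.pos s(c, d)) :
    ProperCross D.pos a b c d := by
  have hv : ∀ v, p ≠ D.pos v := fun v h => hp ⟨v, h.symm⟩
  have hpar : (D.pos b 0 - D.pos a 0) * (D.pos d 1 - D.pos c 1) ≠
      (D.pos b 1 - D.pos a 1) * (D.pos d 0 - D.pos c 0) := by
    intro hpar
    obtain ⟨q, hq, hqp⟩ := exists_second_common_point (D.pos_injective.ne hab.ne)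
      (D.pos_injective.ne hcd.ne) h1 h2 (hv _) (hv _) (hv _) (hv _) hpar
    exact hqp (D.inter_subsingleton _ hab _ hcd hne hq ⟨h1, h2⟩)
  refine ⟨orient_mul_neg_of_mem_segment h1 h2 (hv _) (hv _) hpar,
    orient_mul_neg_of_mem_segment h2 h1 (hv _) (hv _) fun h => hpar ?_⟩
  linarith

open Classical in
/-- Every crossing is seen by exactly eight ordered quadruples of end points. -/
theorem eight_mul_numCrossings [Fintype V] :
    8 * D.numCrossings = (Finset.univ.filter fun x : V × V × V × V =>
      G.Adj x.1 x.2.1 ∧ G.Adj x.2.2.1 x.2.2.2 ∧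
        ProperCross D.pos x.1 x.2.1 x.2.2.1 x.2.2.2).card := by
  set X := Finset.univ.filter fun x : V × V × V × V =>
      G.Adj x.1 x.2.1 ∧ G.Adj x.2.2.1 x.2.2.2 ∧
        ProperCross D.pos x.1 x.2.1 x.2.2.1 x.2.2.2 with hX
  have hmem : ∀ x ∈ X, ∃ p, IsCrossing G D.pos p ∧
      p ∈ edgeSegment D.pos s(x.1, x.2.1) ∩ edgeSegment D.pos s(x.2.2.1, x.2.2.2) := by
    intro x hx
    simp only [hX, Finset.mem_filter, Finset.mem_univ, true_and] at hx
    exact D.isCrossing_of_properCross hx.1 hx.2.1 hx.2.2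
  choose! g hg hg' using hmem
  have huniq : ∀ x ∈ X, ∀ p,
      p ∈ edgeSegment D.pos s(x.1, x.2.1) ∩ edgeSegment D.pos s(x.2.2.1, x.2.2.2) → g x = p := by
    intro x hx p hp
    have hx' := hx
    simp only [hX, Finset.mem_filter, Finset.mem_univ, true_and] at hx'
    exact D.inter_subsingleton _ hx'.1 _ hx'.2.1 hx'.2.2.sym2_ne (hg' x hx) hp
  have himg : {p : Plane | IsCrossing G D.pos p} = ↑(X.image g) := by
    ext p
    simp only [Set.mem_ofPred_eq, Finset.coe_image, Set.mem_image, Finset.mem_coe]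
    constructor
    · intro hp
      obtain ⟨e, f, hef, hS⟩ := Set.ncard_eq_two.1 hp.2
      have he : e ∈ G.edgeSet ∧ p ∈ edgeSegment D.pos e := by
        have : e ∈ ({e, f} : Set (Sym2 V)) := by simp
        rwa [← hS] at this
      have hf : f ∈ G.edgeSet ∧ p ∈ edgeSegment D.pos f := by
        have : f ∈ ({e, f} : Set (Sym2 V)) := by simp
        rwa [← hS] at this
      induction e with | _ a b
      induction f with | _ c d
      have hx : (a, b, c, d) ∈ X := by
        simp only [hX, Finset.mem_filter, Finset.mem_univ, true_and]
        exact ⟨he.1, hf.1, D.properCross_of_mem he.1 hf.1 hef hp.1 he.2 hf.2⟩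
      exact ⟨_, hx, huniq _ hx p ⟨he.2, hf.2⟩⟩
    · rintro ⟨x, hx, rfl⟩
      exact hg x hx
  rw [numCrossings, himg, Set.ncard_coe_finset, Finset.card_eq_sum_card_image g X, mul_comm,
    ← smul_eq_mul, ← Finset.sum_const]
  refine Finset.sum_congr rfl fun p hp => ?_
  obtain ⟨⟨a, b, c, d⟩, hx, rfl⟩ := Finset.mem_image.1 hp
  have hx' := hx
  simp only [hX, Finset.mem_filter, Finset.mem_univ, true_and] at hx'
  obtain ⟨hab, hcd, hpc⟩ := hx'
  obtain ⟨n1, n2, n3, n4⟩ := hpc.ne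
  have hS : {e : Sym2 V | e ∈ G.edgeSet ∧ g (a, b, c, d) ∈ edgeSegment D.pos e} =
      {s(a, b), s(c, d)} := by
    obtain ⟨e, f, hef, hS⟩ := Set.ncard_eq_two.1 (hg _ hx).2
    have h1 : s(a, b) ∈ ({e, f} : Set (Sym2 V)) := hS ▸ ⟨hab, (hg' _ hx).1⟩
    have h2 : s(c, d) ∈ ({e, f} : Set (Sym2 V)) := hS ▸ ⟨hcd, (hg' _ hx).2⟩
    have h3 := hpc.sym2_ne
    rw [hS]
    rcases h1 with h1 | h1 <;> rcases h2 with h2 | h2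
    · exact absurd (h1.trans h2.symm) h3
    · rw [h1, h2]
    · rw [h1, h2, Set.pair_comm]
    · exact absurd (h1.trans h2.symm) h3
  -- The two edges through a crossing can be listed in two orders, and each can be oriented in two
  -- ways.
  have hfib : X.filter (fun x => g x = g (a, b, c, d)) =
      {(a, b, c, d), (b, a, c, d), (a, b, d, c), (b, a, d, c),
        (c, d, a, b), (c, d, b, a), (d, c, a, b), (d, c, b, a)} := by
    ext ⟨a', b', c', d'⟩
    simp only [Finset.mem_filter, Finset.mem_insert, Finset.mem_singleton, Prod.mk.injEq]
    constructor
    · rintro ⟨hx2, hgx⟩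
      have h3 := hx2
      simp only [hX, Finset.mem_filter, Finset.mem_univ, true_and] at h3
      have k1 : s(a', b') ∈ ({s(a, b), s(c, d)} : Set (Sym2 V)) := by
        rw [← hS, ← hgx]; exact ⟨h3.1, (hg' _ hx2).1⟩
      have k2 : s(c', d') ∈ ({s(a, b), s(c, d)} : Set (Sym2 V)) := by
        rw [← hS, ← hgx]; exact ⟨h3.2.1, (hg' _ hx2).2⟩
      obtain ⟨m1, m2, m3, m4⟩ := h3.2.2.ne
      simp only [Set.mem_insert_iff, Set.mem_singleton_iff, Sym2.eq_iff] at k1 k2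
      rcases k1 with (⟨h1, h2⟩ | ⟨h1, h2⟩) | (⟨h1, h2⟩ | ⟨h1, h2⟩) <;>
      rcases k2 with (⟨k1, k2⟩ | ⟨k1, k2⟩) | (⟨k1, k2⟩ | ⟨k1, k2⟩) <;>
      first
      | exact absurd (h1.trans k1.symm) m1
      | exact absurd (h1.trans k2.symm) m2
      | simp only [h1, h2, k1, k2, and_self, true_or, or_true]
    · have hpp := hg' _ hx
      have hba := hab.symm
      have hdc := hcd.symm
      have e1 : s(b, a) = s(a, b) := Sym2.eq_swap
      have e2 : s(d, c) = s(c, d) := Sym2.eq_swap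
      have p1 := hpc.swap
      have p2 := hpc.symm
      have p3 := p2.swap
      have p4 := p1.symm
      have p5 := p4.swap
      have fin : ∀ y ∈ X, g (a, b, c, d) ∈ edgeSegment D.pos s(y.1, y.2.1) ∩
          edgeSegment D.pos s(y.2.2.1, y.2.2.2) → y ∈ X ∧ g y = g (a, b, c, d) :=
        fun y hy h => ⟨hy, huniq y hy _ h⟩
      rintro (⟨rfl, rfl, rfl, rfl⟩ | ⟨rfl, rfl, rfl, rfl⟩ | ⟨rfl, rfl, rfl, rfl⟩ |
        ⟨rfl, rfl, rfl, rfl⟩ | ⟨rfl, rfl, rfl, rfl⟩ | ⟨rfl, rfl, rfl, rfl⟩ |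
        ⟨rfl, rfl, rfl, rfl⟩ | ⟨rfl, rfl, rfl, rfl⟩) <;>
      exact fin _
        (by
          simp only [hX, Finset.mem_filter, Finset.mem_univ, true_and]
          exact ⟨by assumption, by assumption,
            by first | assumption | exact p3.symm | exact p5.symm⟩)
        (by
          first
          | exact hpp
          | (simp only [e1, e2]; first | exact hpp | exact ⟨hpp.2, hpp.1⟩))
  rw [hfib]
  have n5 := hab.ne
  have n6 := hcd.ne
  simp [n1, n2, n3, n4, n5, n6, n1.symm, n2.symm, n3.symm, n4.symm, n5.symm, n6.symm]

end RectilinearDrawing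

/-! ### Generic drawings on the parabola -/

/-- The placement of vertices on the standard parabola with abscissae `t`. -/
noncomputable def parabola {V : Type*} (t : V → ℝ) (v : V) : Plane := !₂[t v, t v ^ 2]

@[simp] theorem parabola_zero {V : Type*} (t : V → ℝ) (v : V) : parabola t v 0 = t v := rfl

@[simp] theorem parabola_one {V : Type*} (t : V → ℝ) (v : V) : parabola t v 1 = t v ^ 2 := rfl

theorem orient_parabola {V : Type*} (t : V → ℝ) (a b c : V) :
    orient (parabola t a) (parabola t b) (parabola t c) =
      (t b - t a) * (t c - t a) * (t c - t b) := by
  simp only [orient, parabola_zero, parabola_one]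
  ring

/-- The determinant that vanishes when the chords `x 0 x 1`, `x 2 x 3`, `x 4 x 5` of the parabola
are concurrent. -/
def chordDet {R : Type*} [CommRing R] (x : Fin 6 → R) : R :=
  (x 0 + x 1) * (x 2 * x 3 - x 4 * x 5) - (x 0 * x 1) * (x 2 + x 3 - (x 4 + x 5)) +
    ((x 2 + x 3) * (x 4 * x 5) - (x 4 + x 5) * (x 2 * x 3))

theorem map_chordDet {R S : Type*} [CommRing R] [CommRing S] (φ : R →+* S) (x : Fin 6 → R) :
    φ (chordDet x) = chordDet fun i => φ (x i) := by
  simp [chordDet]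

/-- Abscissae for which no three disjoint chords of the parabola are concurrent. -/
def ChordGeneric {V : Type*} (t : V → ℝ) : Prop :=
  ∀ x : Fin 6 ↪ V, chordDet (fun i => t (x i)) ≠ 0

theorem exists_injective_chordGeneric (V : Type*) [Finite V] :
    ∃ t : V → ℝ, Function.Injective t ∧ ChordGeneric t := by
  classical
  cases nonempty_fintype V
  let P : MvPolynomial V ℝ :=
    (∏ x : V × V, if x.1 = x.2 then 1 else (MvPolynomial.X x.1 - MvPolynomial.X x.2)) *
      ∏ x : Fin 6 ↪ V, chordDet fun i => (MvPolynomial.X (x i) : MvPolynomial V ℝ)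
  have hP : P ≠ 0 := by
    refine mul_ne_zero (Finset.prod_ne_zero_iff.2 fun x _ => ?_)
      (Finset.prod_ne_zero_iff.2 fun x _ => ?_)
    · split_ifs with h
      · exact one_ne_zero
      · rw [sub_ne_zero]
        exact fun h' => h (MvPolynomial.X_injective h')
    · intro h
      -- At this 0/1 point the second chord has both abscissae 1, the first has 1 and 0, and the
      -- third has 0 and 0, so the determinant equals 1.
      have h' := congrArg (MvPolynomial.eval fun v => if v = x 0 ∨ v = x 2 ∨ v = x 3 then
        (1 : ℝ) else 0) h
      rw [map_chordDet] at h'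
      simp [chordDet] at h'
  obtain ⟨t, ht⟩ : ∃ t : V → ℝ, MvPolynomial.eval t P ≠ 0 := by
    by_contra! h
    exact hP (MvPolynomial.funext fun t => by rw [h t, map_zero])
  rw [map_mul, map_prod, map_prod] at ht
  obtain ⟨h1, h2⟩ := mul_ne_zero_iff.1 ht
  refine ⟨t, fun u v huv => ?_, fun x => ?_⟩
  · by_contra hne
    have := Finset.prod_ne_zero_iff.1 h1 (u, v) (Finset.mem_univ _)
    simp [hne, huv] at this
  · have := Finset.prod_ne_zero_iff.1 h2 x (Finset.mem_univ _)
    rw [map_chordDet] at this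
    simpa using this

theorem exists_strictMono_chordGeneric (n : ℕ) :
    ∃ t : Fin n → ℝ, StrictMono t ∧ ChordGeneric t := by
  obtain ⟨t, ht, hg⟩ := exists_injective_chordGeneric (Fin n)
  exact ⟨t ∘ Tuple.sort t,
    (Tuple.monotone_sort t).strictMono_of_injective (ht.comp (Tuple.sort t).injective),
    fun x => hg (x.trans (Tuple.sort t).toEmbedding)⟩

theorem line_of_mem_edgeSegment_parabola {V : Type*} {t : V → ℝ} {a b : V} {p : Plane}
    (h : p ∈ edgeSegment (parabola t) s(a, b)) : p 1 = (t a + t b) * p 0 - t a * t b := by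
  obtain ⟨θ, -, -, h0, h1⟩ := mem_segment_plane.1 h
  rw [h0, h1, parabola_zero, parabola_zero, parabola_one, parabola_one]
  ring

theorem edgeSegment_parabola_inter_subsingleton {V : Type*} {t : V → ℝ}
    (ht : Function.Injective t) {e f : Sym2 V} (hef : e ≠ f) :
    (edgeSegment (parabola t) e ∩ edgeSegment (parabola t) f).Subsingleton := by
  induction e with | _ a b
  induction f with | _ c d
  intro p hp q hq
  have p1 := line_of_mem_edgeSegment_parabola hp.1
  have p2 := line_of_mem_edgeSegment_parabola hp.2
  have q1 := line_of_mem_edgeSegment_parabola hq.1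
  have q2 := line_of_mem_edgeSegment_parabola hq.2
  by_contra hpq
  have h0 : p 0 - q 0 ≠ 0 := fun h => hpq (plane_ext (by linarith) (by
    rw [p1, q1, sub_eq_zero.1 h]))
  have hS : t a + t b = t c + t d := by
    apply mul_right_cancel₀ h0
    linarith
  have hP : t a * t b = t c * t d := by
    rw [hS] at p1
    linarith
  -- Equal sums and products make {t a, t b} and {t c, t d} the roots of one quadratic.
  have : (t a - t c) * (t a - t d) = 0 := by
    linear_combination (t a) * hS - hP
  rcases mul_eq_zero.1 this with h | h
  · have h1 : a = c := ht (by linarith)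
    have h2 : b = d := ht (by linarith)
    exact hef (by rw [h1, h2])
  · have h1 : a = d := ht (by linarith)
    have h2 : b = c := ht (by linarith)
    exact hef (by rw [h1, h2, Sym2.eq_swap])

theorem vertex_mem_edgeSegment {V : Type*} (pos : V → Plane) {e : Sym2 V} {v : V} (h : v ∈ e) :
    pos v ∈ edgeSegment pos e := by
  induction e with | _ a b
  rcases Sym2.mem_iff.1 h with rfl | rfl
  · exact left_mem_segment ℝ _ _
  · exact right_mem_segment ℝ _ _

/-- The chord with abscissae x, x' lies on the line with slope x + x' and intercept −xx'. Three such
lines through a common point satisfy a determinantal relation, namely that `chordDet` vanishes. The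
six endpoints are distinct because chords with a common endpoint meet only there. -/
theorem chordGeneric_not_concurrent {V : Type*} {t : V → ℝ} (ht : Function.Injective t)
    (hg : ChordGeneric t) {e f g : Sym2 V} (he : ¬ e.IsDiag) (hf : ¬ f.IsDiag) (hgd : ¬ g.IsDiag)
    (hef : e ≠ f) (heg : e ≠ g) (hfg : f ≠ g) {p : Plane} (hp : p ∉ Set.range (parabola t))
    (pe : p ∈ edgeSegment (parabola t) e) (pf : p ∈ edgeSegment (parabola t) f)
    (pg : p ∈ edgeSegment (parabola t) g) : False := by
  have hd : ∀ {e f : Sym2 V}, e ≠ f → p ∈ edgeSegment (parabola t) e →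
      p ∈ edgeSegment (parabola t) f → ∀ v, v ∈ e → v ∉ f := fun hef pe pf v ve vf =>
    hp ⟨v, edgeSegment_parabola_inter_subsingleton ht hef
      ⟨vertex_mem_edgeSegment _ ve, vertex_mem_edgeSegment _ vf⟩ ⟨pe, pf⟩⟩
  have d1 := hd hef pe pf
  have d2 := hd heg pe pg
  have d3 := hd hfg pf pg
  induction e with | _ a b
  induction f with | _ c d
  induction g with | _ i j
  simp only [Sym2.mem_iff, forall_eq_or_imp, forall_eq, not_or, Sym2.mk_isDiag_iff] at *
  have hinj : Function.Injective ![a, b, c, d, i, j] := by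
    intro k l
    fin_cases k <;> fin_cases l <;> simp_all [eq_comm]
  have h1 := line_of_mem_edgeSegment_parabola pe
  have h2 := line_of_mem_edgeSegment_parabola pf
  have h3 := line_of_mem_edgeSegment_parabola pg
  apply hg ⟨_, hinj⟩
  simp only [chordDet, Function.Embedding.coeFn_mk, Matrix.cons_val]
  linear_combination (t i + t j - t c - t d) * h1 + (t a + t b - t i - t j) * h2 +
    (t c + t d - t a - t b) * h3

/-- Every graph is drawn rectilinearly by placing its vertices generically on the parabola. -/
noncomputable def parabolaDrawing {V : Type*} (G : SimpleGraph V) {t : V → ℝ}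
    (ht : Function.Injective t) (hg : ChordGeneric t) : RectilinearDrawing G where
  pos := parabola t
  pos_injective u v h := ht (congrArg (fun p : Plane => p 0) h)
  vertex_on_edge e _ v hv := by
    induction e with | _ a b
    have h := line_of_mem_edgeSegment_parabola hv
    rw [parabola_zero, parabola_one] at h
    have : (t v - t a) * (t v - t b) = 0 := by linear_combination h
    rcases mul_eq_zero.1 this with h | h
    · exact Sym2.mem_iff.2 (Or.inl (ht (by linarith)))
    · exact Sym2.mem_iff.2 (Or.inr (ht (by linarith)))
  inter_subsingleton e _ f _ hef := edgeSegment_parabola_inter_subsingleton ht hef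
  inter_vertex_or_crossing e he f hf hef p hp := by
    by_cases hv : p ∈ Set.range (parabola t)
    · exact Or.inl hv
    refine Or.inr ⟨hv, Set.ncard_eq_two.2 ⟨e, f, hef, ?_⟩⟩
    ext g
    simp only [Set.mem_ofPred_eq, Set.mem_insert_iff, Set.mem_singleton_iff]
    constructor
    · rintro ⟨hgG, pg⟩
      by_contra! hne
      exact chordGeneric_not_concurrent ht hg (G.not_isDiag_of_mem_edgeSet he)
        (G.not_isDiag_of_mem_edgeSet hf) (G.not_isDiag_of_mem_edgeSet hgG) hef hne.1.symm
        hne.2.symm hv hp.1 hp.2 pg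
    · rintro (rfl | rfl)
      · exact ⟨he, hp.1⟩
      · exact ⟨hf, hp.2⟩

/-! ### Perturbation to general position -/

open Filter Topology in
/-- A placement can be perturbed into general position without destroying proper crossings. -/
theorem exists_general_position {V : Type*} [Finite V] (pos : V → Plane) :
    ∃ pos' : V → Plane,
      (∀ a b c, a ≠ b → a ≠ c → b ≠ c → orient (pos' a) (pos' b) (pos' c) ≠ 0) ∧
      ∀ a b c d, ProperCross pos a b c d → ProperCross pos' a b c d := by
  obtain ⟨t, ht, -⟩ := exists_injective_chordGeneric V
  let w : ℝ → V → Plane := fun ε v => pos v + ε • parabola t v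
  have hcont : ∀ a b c, Continuous fun ε => orient (w ε a) (w ε b) (w ε c) := by
    intro a b c
    simp only [orient, w, PiLp.add_apply, PiLp.smul_apply, smul_eq_mul]
    fun_prop
  have hw : w 0 = pos := by
    funext v
    simp [w]
  have h1 : ∀ᶠ ε in 𝓝[≠] (0 : ℝ), ∀ a b c, a ≠ b → a ≠ c → b ≠ c →
      orient (w ε a) (w ε b) (w ε c) ≠ 0 := by
    simp only [eventually_all]
    intro a b c hab hac hbc
    -- The orientation of a perturbed triple is a quadratic polynomial in ε. Its leading coefficient
    -- is the orientation of three distinct points of the parabola, hence nonzero, so only finitely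
    -- many ε are bad.
    refine nhdsNE_le_cofinite (a := (0 : ℝ)) ?_
    let B : ℝ := (pos b 0 - pos a 0) * (t c ^ 2 - t a ^ 2) + (t b - t a) * (pos c 1 - pos a 1) -
      ((pos b 1 - pos a 1) * (t c - t a) + (t b ^ 2 - t a ^ 2) * (pos c 0 - pos a 0))
    let P : Polynomial ℝ := Polynomial.C (orient (parabola t a) (parabola t b) (parabola t c)) *
      Polynomial.X ^ 2 + Polynomial.C B * Polynomial.X +
      Polynomial.C (orient (pos a) (pos b) (pos c))
    have hP : P ≠ 0 := by
      intro h
      have h2 := congrArg (fun p => Polynomial.coeff p 2) h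
      simp only [P, Polynomial.coeff_zero] at h2
      simp at h2
      rw [orient_parabola] at h2
      simp only [mul_eq_zero, sub_eq_zero, ht.eq_iff] at h2
      tauto
    refine (P.finite_setOfPred_isRoot hP).subset ?_
    intro ε hε
    simp only [Set.mem_compl_iff, Set.mem_ofPred_eq, not_not] at hε
    simp only [Set.mem_ofPred_eq, Polynomial.IsRoot.def]
    rw [← hε]
    simp [P, B, w, orient]
    ring
  have h2 : ∀ᶠ ε in 𝓝[≠] (0 : ℝ), ∀ a b c d, ProperCross pos a b c d →
      ProperCross (w ε) a b c d := by
    refine Filter.Eventually.filter_mono nhdsWithin_le_nhds ?_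
    simp only [eventually_all]
    intro a b c d h
    rw [← hw] at h
    exact (((hcont a b c).mul (hcont a b d)).tendsto 0 |>.eventually_lt_const h.1).and
      (((hcont c d a).mul (hcont c d b)).tendsto 0 |>.eventually_lt_const h.2)
  obtain ⟨ε, hε⟩ := (h1.and h2).exists
  exact ⟨w ε, hε⟩

/-! ### Indicators and sign patterns of orientations -/

open Classical in
/-- The integer indicator of a proposition. -/
noncomputable def ind (p : Prop) : ℤ := if p then 1 else 0

theorem ind_true {p : Prop} (h : p) : ind p = 1 := by simp [ind, h]

theorem ind_false {p : Prop} (h : ¬ p) : ind p = 0 := by simp [ind, h]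

theorem ind_nonneg (p : Prop) : 0 ≤ ind p := by unfold ind; split_ifs <;> simp

theorem ind_congr {p q : Prop} (h : p ↔ q) : ind p = ind q := by rw [propext h]

theorem ind_mul_neg (x y : ℝ) :
    ind (x * y < 0) = ind (0 < x) * ind (y < 0) + ind (x < 0) * ind (0 < y) := by
  rcases lt_trichotomy x 0 with hx | hx | hx <;> rcases lt_trichotomy y 0 with hy | hy | hy <;>
    simp [ind, mul_neg_iff, hx, hy, hx.le, hy.le, not_lt.2]

theorem sum_mul_ind_eq {V : Type*} [Fintype V] (f : V → ℤ) (a : V) :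
    ∑ x, f x * ind (a = x) = f a := by
  classical
  simp [ind]

theorem sum_ind_eq {V : Type*} [Fintype V] (a : V) : ∑ x, ind (a = x) = 1 := by
  classical
  simp [ind]

theorem four_mul_sum_eq {V : Type*} [Fintype V] (F : V → V → V → V → ℤ) :
    4 * ∑ a, ∑ b, ∑ c, ∑ e, F a b c e =
      ∑ a, ∑ b, ∑ c, ∑ e, (F a b c e + F b a c e + F a b e c + F b a e c) := by
  have r1 : ∑ a, ∑ b, ∑ c, ∑ e, F b a c e = ∑ a, ∑ b, ∑ c, ∑ e, F a b c e := Finset.sum_comm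
  have r2 : ∑ a, ∑ b, ∑ c, ∑ e, F a b e c = ∑ a, ∑ b, ∑ c, ∑ e, F a b c e :=
    Finset.sum_congr rfl fun _ _ => Finset.sum_congr rfl fun _ _ => Finset.sum_comm
  have r3 : ∑ a, ∑ b, ∑ c, ∑ e, F b a e c = ∑ a, ∑ b, ∑ c, ∑ e, F a b c e :=
    Finset.sum_comm.trans r2
  simp only [Finset.sum_add_distrib, r1, r2, r3]
  ring

/-- Among three nonzero reals, two have the same sign. -/
theorem one_le_separated_triples {x y z : ℝ} (hx : x ≠ 0) (hy : y ≠ 0) (hz : z ≠ 0) :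
    1 ≤ ind (x * -z < 0) + ind (y * -x < 0) + ind (z * -y < 0) := by
  rcases lt_or_gt_of_ne hx with hx | hx <;> rcases lt_or_gt_of_ne hy with hy | hy <;>
    rcases lt_or_gt_of_ne hz with hz | hz <;>
    simp [ind, mul_pos_iff, hx, hy, hz, hx.le, hy.le, hz.le, not_lt.2]

/-- If pq > 0 or rs > 0, exactly two of the four conditions hold. If both products are negative, the
linear relation forces p and s to have one sign and q and r the other, and none holds. -/
theorem separated_diagonals_le {p q r s : ℝ} (hp : p ≠ 0) (hq : q ≠ 0) (hr : r ≠ 0) (hs : s ≠ 0)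
    (h : p - q + r - s = 0) :
    ind (p * s < 0) + ind (-p * r < 0) + ind (q * -s < 0) + ind (-q * -r < 0) ≤
      2 * (1 - ind (p * q < 0 ∧ r * s < 0)) := by
  rcases lt_or_gt_of_ne hp with hp | hp <;> rcases lt_or_gt_of_ne hq with hq | hq <;>
    rcases lt_or_gt_of_ne hr with hr | hr <;> rcases lt_or_gt_of_ne hs with hs | hs <;>
    first
    | (exfalso; linarith)
    | simp [ind, mul_pos_iff, mul_neg_iff, hp, hq, hr, hs, hp.le, hq.le, hr.le, hs.le, not_lt.2]

theorem one_le_separated_neighbours {u a b c : Plane} (h1 : orient u a b ≠ 0)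
    (h2 : orient u b c ≠ 0) (h3 : orient u c a ≠ 0) :
    1 ≤ ind (orient u a b * orient u a c < 0) + ind (orient u b c * orient u b a < 0) +
      ind (orient u c a * orient u c b < 0) := by
  have e1 : orient u a c = -orient u c a := by simp only [orient]; ring
  have e2 : orient u b a = -orient u a b := by simp only [orient]; ring
  have e3 : orient u c b = -orient u b c := by simp only [orient]; ring
  rw [e1, e2, e3]
  exact one_le_separated_triples h1 h2 h3

theorem separated_connections_le {a b c d : Plane} (h1 : orient a b c ≠ 0)
    (h2 : orient a b d ≠ 0) (h3 : orient c d a ≠ 0) (h4 : orient c d b ≠ 0) :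
    ind (orient b c a * orient b c d < 0) + ind (orient a c b * orient a c d < 0) +
      ind (orient b d a * orient b d c < 0) + ind (orient a d b * orient a d c < 0) ≤
      2 * (1 - ind (orient a b c * orient a b d < 0 ∧ orient c d a * orient c d b < 0)) := by
  have e1 : orient b c a = orient a b c := by simp only [orient]; ring
  have e2 : orient b c d = orient c d b := by simp only [orient]; ring
  have e3 : orient a c b = -orient a b c := by simp only [orient]; ring
  have e4 : orient a c d = orient c d a := by simp only [orient]; ring
  have e5 : orient b d a = orient a b d := by simp only [orient]; ring
  have e6 : orient b d c = -orient c d b := by simp only [orient]; ring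
  have e7 : orient a d b = -orient a b d := by simp only [orient]; ring
  have e8 : orient a d c = -orient c d a := by simp only [orient]; ring
  rw [e1, e2, e3, e4, e5, e6, e7, e8]
  -- The relation says that both diagonals cut the quadrilateral abcd into triangles of the same
  -- total signed area.
  exact separated_diagonals_le h1 h2 h3 h4 (by simp only [orient]; ring)

theorem orient_self_left (a b : Plane) : orient a a b = 0 := by simp [orient]

theorem orient_self_right (a b : Plane) : orient a b b = 0 := by simp [orient, mul_comm]

theorem orient_self_outer (a b : Plane) : orient a b a = 0 := by simp [orient]

/-! ### The upper bound by double counting -/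

section Counting

variable {V : Type*} [Fintype V] {G : SimpleGraph V} {d : ℤ}

/-- Inclusion–exclusion over the coincidences among v, a, b; the coefficient 2 corrects for the case
in which all three agree. -/
theorem sum_distinct_triples (hG : ∀ u, ∑ v, ind (G.Adj u v) = d) (u : V) :
    ∑ v, ∑ a, ∑ b, ind (G.Adj u v) * ind (G.Adj u a) * ind (G.Adj u b) *
      ((1 - ind (v = a)) * (1 - ind (v = b)) * (1 - ind (a = b))) = d * (d - 1) * (d - 2) := by
  have h : ∀ v a b, ind (G.Adj u v) * ind (G.Adj u a) * ind (G.Adj u b) *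
      ((1 - ind (v = a)) * (1 - ind (v = b)) * (1 - ind (a = b))) =
      ind (G.Adj u v) * (ind (G.Adj u a) * ind (G.Adj u b))
        - ind (G.Adj u a) * (ind (G.Adj u v) * ind (v = b))
        - ind (G.Adj u v) * (ind (G.Adj u a) * ind (a = b))
        - ind (G.Adj u v) * (ind (v = a) * ind (G.Adj u b))
        + 2 * (ind (G.Adj u v) * (ind (v = a) * ind (a = b))) := by
    intro v a b
    have i1 : (1 - ind (v = a)) * (1 - ind (v = b)) * (1 - ind (a = b)) =
        1 - ind (v = a) - ind (v = b) - ind (a = b) + 2 * (ind (v = a) * ind (a = b)) := by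
      simp only [ind]; grind
    have i2 : ind (G.Adj u v) * ind (G.Adj u a) * ind (G.Adj u b) *
        (ind (v = a) * ind (a = b)) = ind (G.Adj u v) * (ind (v = a) * ind (a = b)) := by
      simp only [ind]; grind
    have i3 : ind (G.Adj u v) * ind (G.Adj u b) * ind (v = b) =
        ind (G.Adj u v) * ind (v = b) := by
      simp only [ind]; grind
    have i4 : ind (G.Adj u a) * ind (G.Adj u b) * ind (a = b) =
        ind (G.Adj u a) * ind (a = b) := by
      simp only [ind]; grind
    have i5 : ind (G.Adj u v) * ind (G.Adj u a) * ind (v = a) =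
        ind (G.Adj u v) * ind (v = a) := by
      simp only [ind]; grind
    rw [i1]
    linear_combination 2 * i2 - ind (G.Adj u a) * i3 - ind (G.Adj u v) * i4 -
      ind (G.Adj u b) * i5
  simp only [h, Finset.sum_add_distrib, Finset.sum_sub_distrib, ← Finset.mul_sum,
    ← Finset.sum_mul, sum_ind_eq, hG, mul_one, one_mul]
  ring

/-- Rotating the triple (v, a, b) turns three copies of the sum into one sum over triples of
neighbours, in which every triple of distinct neighbours contributes at least 1. -/
theorem three_mul_sum_separated (hG : ∀ u, ∑ v, ind (G.Adj u v) = d) {pos : V → Plane}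
    (hpos : ∀ a b c, a ≠ b → a ≠ c → b ≠ c → orient (pos a) (pos b) (pos c) ≠ 0) (u : V) :
    d * (d - 1) * (d - 2) ≤ 3 * ∑ v, ∑ a, ∑ b, ind (G.Adj u v) * ind (G.Adj u a) *
      ind (G.Adj u b) *
      ind (orient (pos u) (pos v) (pos a) * orient (pos u) (pos v) (pos b) < 0) := by
  set F : V → V → V → ℤ := fun v a b => ind (G.Adj u v) * ind (G.Adj u a) * ind (G.Adj u b) *
      ind (orient (pos u) (pos v) (pos a) * orient (pos u) (pos v) (pos b) < 0) with hF
  have r1 : ∑ v, ∑ a, ∑ b, F a b v = ∑ v, ∑ a, ∑ b, F v a b := by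
    rw [Finset.sum_comm]
    exact Finset.sum_congr rfl fun _ _ => Finset.sum_comm
  have r2 : ∑ v, ∑ a, ∑ b, F b v a = ∑ v, ∑ a, ∑ b, F v a b := by
    exact (Finset.sum_congr rfl fun _ _ => Finset.sum_comm).trans Finset.sum_comm
  have : 3 * ∑ v, ∑ a, ∑ b, F v a b = ∑ v, ∑ a, ∑ b, (F v a b + F a b v + F b v a) := by
    simp only [Finset.sum_add_distrib, r1, r2]
    ring
  rw [this, ← sum_distinct_triples hG u]
  refine Finset.sum_le_sum fun v _ => Finset.sum_le_sum fun a _ => Finset.sum_le_sum fun b _ => ?_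
  have hnn : ∀ v a b, 0 ≤ F v a b := fun v a b => mul_nonneg (mul_nonneg (mul_nonneg
    (ind_nonneg _) (ind_nonneg _)) (ind_nonneg _)) (ind_nonneg _)
  by_cases h : (G.Adj u v ∧ G.Adj u a ∧ G.Adj u b) ∧ v ≠ a ∧ v ≠ b ∧ a ≠ b
  · obtain ⟨⟨g1, g2, g3⟩, n1, n2, n3⟩ := h
    simp only [hF, ind_true g1, ind_true g2, ind_true g3, ind_false n1, ind_false n2,
      ind_false n3]
    simpa using one_le_separated_neighbours (hpos u v a g1.ne g2.ne n1)
      (hpos u a b g2.ne g3.ne n3) (hpos u b v g3.ne g1.ne n2.symm)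
  · have h0 : ind (G.Adj u v) * ind (G.Adj u a) * ind (G.Adj u b) *
      ((1 - ind (v = a)) * (1 - ind (v = b)) * (1 - ind (a = b))) = 0 := by
      by_contra h0
      apply h
      simp only [mul_ne_zero_iff, ne_eq, ind, sub_eq_zero] at h0
      grind
    rw [h0]
    have := hnn v a b
    have := hnn a b v
    have := hnn b v a
    positivity

/-- Inclusion–exclusion over (nd)² pairs of darts. Each of the four possible coincidences of
endpoints removes nd·d pairs, and the nd equal and nd reversed pairs, removed twice, are added back
once. -/
theorem sum_disjoint_darts (hG : ∀ u, ∑ v, ind (G.Adj u v) = d) :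
    ∑ a, ∑ b, ∑ c, ∑ e, ind (G.Adj a b) * ind (G.Adj c e) *
      ((1 - ind (a = c)) * (1 - ind (a = e)) * ((1 - ind (b = c)) * (1 - ind (b = e)))) =
      Fintype.card V * d * (Fintype.card V * d - 4 * d + 2) := by
  have hG' : ∀ u, ∑ v, ind (G.Adj v u) = d := fun u => by
    rw [← hG u]
    exact Finset.sum_congr rfl fun v _ => ind_congr (G.adj_comm v u)
  have h : ∀ a b c e, ind (G.Adj a b) * ind (G.Adj c e) *
      ((1 - ind (a = c)) * (1 - ind (a = e)) * ((1 - ind (b = c)) * (1 - ind (b = e)))) =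
      ind (G.Adj a b) * ind (G.Adj c e)
      - ind (G.Adj a b) * (ind (G.Adj c e) * ind (a = c))
      - ind (G.Adj a b) * (ind (G.Adj c e) * ind (a = e))
      - ind (G.Adj a b) * (ind (G.Adj c e) * ind (b = c))
      - ind (G.Adj a b) * (ind (G.Adj c e) * ind (b = e))
      + ind (G.Adj a b) * ind (a = c) * ind (b = e)
      + ind (G.Adj a b) * ind (b = c) * ind (a = e) := by
    intro a b c e
    have irr : ∀ x, ¬ G.Adj x x := fun x => G.irrefl
    have i1 : ind (G.Adj a b) * (ind (a = c) * ind (b = c)) = 0 := by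
      simp only [ind]; grind
    have i2 : ind (G.Adj a b) * (ind (a = e) * ind (b = e)) = 0 := by
      simp only [ind]; grind
    have i3 : ind (G.Adj c e) * (ind (a = c) * ind (a = e)) = 0 := by
      simp only [ind]; grind
    have i4 : ind (G.Adj c e) * (ind (b = c) * ind (b = e)) = 0 := by
      simp only [ind]; grind
    have i5 : ind (G.Adj a b) * ind (G.Adj c e) * (ind (a = c) * ind (b = e)) =
        ind (G.Adj a b) * ind (a = c) * ind (b = e) := by
      simp only [ind]; grind
    have i6 : ind (G.Adj a b) * ind (G.Adj c e) * (ind (b = c) * ind (a = e)) =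
        ind (G.Adj a b) * ind (b = c) * ind (a = e) := by
      simp only [ind]; grind [G.adj_comm]
    linear_combination i5 + i6 + ind (G.Adj a b) * i3 + ind (G.Adj a b) * i4 +
      ind (G.Adj c e) * (1 - ind (a = e) - ind (b = e)) * i1 +
      ind (G.Adj c e) * (1 - ind (a = c) - ind (b = c) + ind (a = c) * ind (b = c)) * i2
  simp only [h, Finset.sum_add_distrib, Finset.sum_sub_distrib, ← Finset.mul_sum,
    ← Finset.sum_mul, sum_mul_ind_eq, hG, hG', sum_ind_eq, mul_one, Finset.sum_const,
    Finset.card_univ, nsmul_eq_mul]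
  ring

/-- Reversing either edge runs through the four lines that connect them. So
`separated_connections_le` bounds four copies of the left sum by twice the number of disjoint
non-crossing pairs. Pairs with a common vertex contribute nothing. -/
theorem two_mul_sum_separated_le {pos : V → Plane}
    (hpos : ∀ a b c, a ≠ b → a ≠ c → b ≠ c → orient (pos a) (pos b) (pos c) ≠ 0) :
    2 * ∑ a, ∑ b, ∑ c, ∑ e, ind (G.Adj a b) * ind (G.Adj c e) *
      ind (orient (pos b) (pos c) (pos a) * orient (pos b) (pos c) (pos e) < 0) ≤
    ∑ a, ∑ b, ∑ c, ∑ e, ind (G.Adj a b) * ind (G.Adj c e) *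
      ((1 - ind (a = c)) * (1 - ind (a = e)) * ((1 - ind (b = c)) * (1 - ind (b = e)))) -
    ∑ a, ∑ b, ∑ c, ∑ e, ind (G.Adj a b) * ind (G.Adj c e) * ind (ProperCross pos a b c e) := by
  set F : V → V → V → V → ℤ := fun a b c e => ind (G.Adj a b) * ind (G.Adj c e) *
      ind (orient (pos b) (pos c) (pos a) * orient (pos b) (pos c) (pos e) < 0) with hF
  suffices h : ∑ a, ∑ b, ∑ c, ∑ e, (F a b c e + F b a c e + F a b e c + F b a e c) ≤
      ∑ a, ∑ b, ∑ c, ∑ e, 2 * (ind (G.Adj a b) * ind (G.Adj c e) *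
      ((1 - ind (a = c)) * (1 - ind (a = e)) * ((1 - ind (b = c)) * (1 - ind (b = e)))) -
      ind (G.Adj a b) * ind (G.Adj c e) * ind (ProperCross pos a b c e)) by
    rw [← four_mul_sum_eq F] at h
    simp only [← Finset.mul_sum, Finset.sum_sub_distrib] at h
    linarith
  refine Finset.sum_le_sum fun a _ => Finset.sum_le_sum fun b _ => Finset.sum_le_sum fun c _ =>
    Finset.sum_le_sum fun e _ => ?_
  by_cases h : G.Adj a b ∧ G.Adj c e
  · obtain ⟨h1, h2⟩ := h
    simp only [hF, ind_true h1, ind_true h2, ind_true h1.symm, ind_true h2.symm, one_mul]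
    by_cases hn : a ≠ c ∧ a ≠ e ∧ b ≠ c ∧ b ≠ e
    · obtain ⟨n1, n2, n3, n4⟩ := hn
      rw [ind_false n1, ind_false n2, ind_false n3, ind_false n4]
      have := separated_connections_le (hpos a b c h1.ne n1 n3) (hpos a b e h1.ne n2 n4)
        (hpos c e a h2.ne n1.symm n2.symm) (hpos c e b h2.ne n3.symm n4.symm)
      simpa [ProperCross] using this
    · have h0 : (1 - ind (a = c)) * (1 - ind (a = e)) *
          ((1 - ind (b = c)) * (1 - ind (b = e))) = 0 := by
        simp only [ind]; grind
      have hx : ind (ProperCross pos a b c e) = 0 := ind_false fun hx => hn hx.ne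
      rw [h0, hx]
      have hs : ∀ x : ℝ, ind (x * x < 0) = 0 := fun x => ind_false (mul_self_nonneg x).not_gt
      have hn' : a = c ∨ a = e ∨ b = c ∨ b = e := by tauto
      rcases hn' with rfl | rfl | rfl | rfl <;>
        simp [orient_self_left, orient_self_right, orient_self_outer, hs, ind_false not_false]
  · have h0 : ind (G.Adj a b) * ind (G.Adj c e) = 0 := by
      simp only [ind]; grind
    simp [hF, h0, ind_congr (G.adj_comm b a), ind_congr (G.adj_comm e c)]

theorem sum_same_side_mul (u v : V) (s : V → ℝ) :
    ∑ a, ∑ b, ind (G.Adj u a) * ind (G.Adj v b) * ind (s a * s b < 0) =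
      (∑ a, ind (G.Adj u a) * ind (0 < s a)) * (∑ b, ind (G.Adj v b) * ind (s b < 0)) +
      (∑ a, ind (G.Adj u a) * ind (s a < 0)) * (∑ b, ind (G.Adj v b) * ind (0 < s b)) := by
  rw [Finset.sum_mul_sum, Finset.sum_mul_sum, ← Finset.sum_add_distrib]
  refine Finset.sum_congr rfl fun a _ => ?_
  rw [← Finset.sum_add_distrib]
  refine Finset.sum_congr rfl fun b _ => ?_
  rw [ind_mul_neg]
  ring

/-- The neighbour v itself lies on the line uv and is on neither side, which leaves d − 1
neighbours. -/
theorem sum_sides_add (hG : ∀ u, ∑ v, ind (G.Adj u v) = d) {u v : V} (huv : G.Adj u v)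
    {s : V → ℝ} (hv : s v = 0) (hs : ∀ a, G.Adj u a → a ≠ v → s a ≠ 0) :
    ∑ a, ind (G.Adj u a) * ind (0 < s a) + ∑ a, ind (G.Adj u a) * ind (s a < 0) = d - 1 := by
  rw [← Finset.sum_add_distrib, ← hG u, ← ind_true huv,
    ← sum_mul_ind_eq (fun a => ind (G.Adj u a)) v, ← Finset.sum_sub_distrib]
  refine Finset.sum_congr rfl fun a _ => ?_
  by_cases hva : v = a
  · subst hva
    simp [hv, ind]
  · rw [ind_false hva]
    by_cases hua : G.Adj u a
    · rcases lt_or_gt_of_ne (hs a hua (Ne.symm hva)) with h | h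
      · simp [ind, h, h.le, not_lt.2]
      · simp [ind, h, h.le, not_lt.2]
    · simp [ind_false hua]

/-- This compares separated pairs attached to the two ends of a segment uv with separated pairs
attached to one end of an edge uv. Sides are measured from each end, so left at u is right at v, and
opposite sides pair l with l and r with r. -/
theorem sum_two_sided_le (hG : ∀ u, ∑ v, ind (G.Adj u v) = d) {pos : V → Plane}
    (hpos : ∀ a b c, a ≠ b → a ≠ c → b ≠ c → orient (pos a) (pos b) (pos c) ≠ 0) :
    ∑ u, ∑ v, ∑ a, ∑ b, ind (G.Adj u v) * ind (G.Adj u a) * ind (G.Adj u b) *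
      ind (orient (pos u) (pos v) (pos a) * orient (pos u) (pos v) (pos b) < 0) ≤
    ∑ a, ∑ b, ∑ c, ∑ e, ind (G.Adj a b) * ind (G.Adj c e) *
      ind (orient (pos b) (pos c) (pos a) * orient (pos b) (pos c) (pos e) < 0) := by
  have hW : ∑ a, ∑ b, ∑ c, ∑ e, ind (G.Adj a b) * ind (G.Adj c e) *
      ind (orient (pos b) (pos c) (pos a) * orient (pos b) (pos c) (pos e) < 0) =
      ∑ u, ∑ v, ∑ a, ∑ b, ind (G.Adj u a) * ind (G.Adj v b) *
      ind (orient (pos u) (pos v) (pos a) * orient (pos u) (pos v) (pos b) < 0) := by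
    rw [Finset.sum_comm]
    refine Finset.sum_congr rfl fun u _ => ?_
    rw [Finset.sum_comm]
    refine Finset.sum_congr rfl fun v _ => Finset.sum_congr rfl fun a _ =>
      Finset.sum_congr rfl fun b _ => ?_
    rw [ind_congr (G.adj_comm a u)]
  rw [hW]
  set l : V → V → ℤ := fun u v =>
    ∑ a, ind (G.Adj u a) * ind (0 < orient (pos u) (pos v) (pos a)) with hl
  set r : V → V → ℤ := fun u v =>
    ∑ a, ind (G.Adj u a) * ind (orient (pos u) (pos v) (pos a) < 0) with hr
  have hanti : ∀ u v a : V, orient (pos u) (pos v) (pos a) = -orient (pos v) (pos u) (pos a) := by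
    intro u v a
    simp only [orient]
    ring
  have hl' : ∀ u v, ∑ b, ind (G.Adj v b) * ind (0 < orient (pos u) (pos v) (pos b)) = r v u := by
    intro u v
    simp only [hr, hanti u v, Left.neg_pos_iff]
  have hr' : ∀ u v, ∑ b, ind (G.Adj v b) * ind (orient (pos u) (pos v) (pos b) < 0) = l v u := by
    intro u v
    simp only [hl, hanti u v, Left.neg_neg_iff]
  have hlr : ∀ u v, G.Adj u v → l u v + r u v = d - 1 := fun u v huv =>
    sum_sides_add hG huv (orient_self_right _ _) fun a hua hav =>
      hpos u v a huv.ne hua.ne hav.symm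
  calc _ = ∑ u, ∑ v, ind (G.Adj u v) * (2 * (l u v * r u v)) := by
        refine Finset.sum_congr rfl fun u _ => Finset.sum_congr rfl fun v _ => ?_
        have := sum_same_side_mul (G := G) u u fun a => orient (pos u) (pos v) (pos a)
        simp only [mul_assoc, ← Finset.mul_sum] at this ⊢
        rw [this]
        ring
    _ = ∑ u, ∑ v, ind (G.Adj u v) * (l u v * r u v + l v u * r v u) := by
        have h : ∑ u, ∑ v, ind (G.Adj u v) * (l v u * r v u) =
            ∑ u, ∑ v, ind (G.Adj u v) * (l u v * r u v) := by
          rw [Finset.sum_comm]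
          refine Finset.sum_congr rfl fun u _ => Finset.sum_congr rfl fun v _ => ?_
          rw [ind_congr (G.adj_comm v u)]
        simp only [mul_add, two_mul, Finset.sum_add_distrib, h]
    _ ≤ ∑ u, ∑ v, ind (G.Adj u v) * (l u v * l v u + r u v * r v u) := by
        refine Finset.sum_le_sum fun u _ => Finset.sum_le_sum fun v _ => ?_
        by_cases huv : G.Adj u v
        · refine mul_le_mul_of_nonneg_left ?_ (ind_nonneg _)
          have h1 := hlr u v huv
          have h2 := hlr v u huv.symm
          have h3 : r u v = d - 1 - l u v := by linarith
          have h4 : r v u = d - 1 - l v u := by linarith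
          rw [h3, h4]
          -- The difference of the two sides is exactly this square.
          nlinarith [sq_nonneg (l u v - (d - 1 - l v u))]
        · simp [ind_false huv]
    _ ≤ _ := by
        refine Finset.sum_le_sum fun u _ => Finset.sum_le_sum fun v _ => ?_
        rw [sum_same_side_mul u v fun a => orient (pos u) (pos v) (pos a), hl', hr']
        have hnl : ∀ u v, 0 ≤ l u v := fun u v =>
          Finset.sum_nonneg fun a _ => mul_nonneg (ind_nonneg _) (ind_nonneg _)
        have hnr : ∀ u v, 0 ≤ r u v := fun u v =>
          Finset.sum_nonneg fun a _ => mul_nonneg (ind_nonneg _) (ind_nonneg _)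
        have h0 : 0 ≤ l u v * l v u + r u v * r v u :=
          add_nonneg (mul_nonneg (hnl _ _) (hnl _ _)) (mul_nonneg (hnr _ _) (hnr _ _))
        by_cases huv : G.Adj u v
        · rw [ind_true huv, one_mul]
        · rw [ind_false huv, zero_mul]
          exact h0

/-- In a placement in general position of a `d`-regular graph, the number of crossing pairs of edges is bounded by
that of the extremal convex drawing. -/
theorem three_mul_sum_properCross_le (hG : ∀ u, ∑ v, ind (G.Adj u v) = d) {pos : V → Plane}
    (hpos : ∀ a b c, a ≠ b → a ≠ c → b ≠ c → orient (pos a) (pos b) (pos c) ≠ 0) :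
    3 * ∑ a, ∑ b, ∑ c, ∑ e, ind (G.Adj a b) * ind (G.Adj c e) * ind (ProperCross pos a b c e) ≤
      Fintype.card V * d * (3 * Fintype.card V * d - 2 * d ^ 2 - 6 * d + 2) := by
  have h1 := two_mul_sum_separated_le (G := G) hpos
  rw [sum_disjoint_darts hG] at h1
  have h2 := sum_two_sided_le hG hpos
  have h3 : Fintype.card V * (d * (d - 1) * (d - 2)) ≤
      3 * ∑ u, ∑ v, ∑ a, ∑ b, ind (G.Adj u v) * ind (G.Adj u a) * ind (G.Adj u b) *
      ind (orient (pos u) (pos v) (pos a) * orient (pos u) (pos v) (pos b) < 0) := by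
    rw [Finset.mul_sum, ← nsmul_eq_mul, ← Finset.card_univ, ← Finset.sum_const]
    exact Finset.sum_le_sum fun u _ => three_mul_sum_separated hG hpos u
  linarith

end Counting

/-! ### The extremal graph in convex position -/

/-- The graph on `Fin n` that joins two vertices when their cyclic distance is at least `s`. -/
def antipodalGraph (n s : ℕ) : SimpleGraph (Fin n) where
  Adj i j := (i.val < j ∧ i.val + s ≤ j ∧ j.val + s ≤ n + i) ∨
    (j.val < i ∧ j.val + s ≤ i ∧ i.val + s ≤ n + j)
  symm := ⟨fun _ _ h => h.symm⟩
  loopless := ⟨fun _ h => by simp at h⟩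

theorem antipodalGraph_adj {n s : ℕ} {i j : Fin n} : (antipodalGraph n s).Adj i j ↔
    (i.val < j ∧ i.val + s ≤ j ∧ j.val + s ≤ n + i) ∨
    (j.val < i ∧ j.val + s ≤ i ∧ i.val + s ≤ n + j) := Iff.rfl

open Classical in
theorem card_filter_antipodalGraph_adj {n d s : ℕ} (hs : 1 ≤ s) (hn : n + 1 = d + 2 * s)
    (u : Fin n) : (Finset.univ.filter fun v => (antipodalGraph n s).Adj u v).card = d := by
  rw [← Finset.card_range d]
  -- The neighbours of u are those at forward cyclic distance s, …, s + d − 1 = n − s; subtracting s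
  -- numbers them by 0, …, d − 1.
  refine Finset.card_bij (fun v _ => (if u.val < v.val then v.val - u else v.val + n - u) - s)
    ?_ ?_ ?_
  · intro v hv
    simp only [Finset.mem_filter, Finset.mem_univ, true_and, antipodalGraph_adj] at hv
    simp only [Finset.mem_range]
    split_ifs <;> omega
  · intro v hv w hw h
    simp only [Finset.mem_filter, Finset.mem_univ, true_and, antipodalGraph_adj] at hv hw
    apply Fin.ext
    split_ifs at h <;> omega
  · intro k hk
    rw [Finset.mem_range] at hk
    by_cases h : u.val + s + k < n
    · refine ⟨⟨u.val + s + k, h⟩, ?_, ?_⟩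
      · simp only [Finset.mem_filter, Finset.mem_univ, true_and, antipodalGraph_adj]
        omega
      · simp only
        split_ifs <;> omega
    · refine ⟨⟨u.val + s + k - n, by omega⟩, ?_, ?_⟩
      · simp only [Finset.mem_filter, Finset.mem_univ, true_and, antipodalGraph_adj]
        omega
      · simp only
        split_ifs <;> omega

theorem sum_ind {V : Type*} [Fintype V] (p : V → Prop) [DecidablePred p] :
    ∑ v, ind (p v) = (Finset.univ.filter p).card := by
  classical
  have h : ∀ v, ind (p v) = if p v then 1 else 0 := fun v => by
    unfold ind
    congr
  rw [Finset.sum_congr rfl fun v _ => h v, Finset.sum_boole]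

theorem sum_antipodalGraph_adj {n d s : ℕ} (hs : 1 ≤ s) (hn : n + 1 = d + 2 * s)
    (u : Fin n) : ∑ v, ind ((antipodalGraph n s).Adj u v) = d := by
  classical
  rw [sum_ind, card_filter_antipodalGraph_adj hs hn]

/-- `a, b, c, e` follow each other in this cyclic order. -/
def CyclicOrder {n : ℕ} (a b c e : Fin n) : Prop :=
  (a < b ∧ b < c ∧ c < e) ∨ (b < c ∧ c < e ∧ e < a) ∨ (c < e ∧ e < a ∧ a < b) ∨
    (e < a ∧ a < b ∧ b < c)

/-- Chords of a convex curve cross exactly when their ends alternate. If they do not alternate,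
orienting both chords suitably makes their four ends follow each other cyclically. -/
theorem cyclicOrder_of_not_properCross {n : ℕ} {t : Fin n → ℝ} (ht : StrictMono t)
    {a b c e : Fin n} (hab : a ≠ b) (hac : a ≠ c) (hae : a ≠ e) (hbc : b ≠ c) (hbe : b ≠ e)
    (hce : c ≠ e) (h : ¬ ProperCross (parabola t) a b c e) :
    CyclicOrder a b c e ∨ CyclicOrder b a c e ∨ CyclicOrder a b e c ∨ CyclicOrder b a e c := by
  by_contra hcon
  apply h
  have hneg : ∀ x : Fin n, (a < x ∧ x < b) ∨ (b < x ∧ x < a) →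
      (t x - t a) * (t x - t b) < 0 := by
    rintro x (⟨h1, h2⟩ | ⟨h1, h2⟩)
    · exact mul_neg_of_pos_of_neg (sub_pos.2 (ht h1)) (sub_neg.2 (ht h2))
    · exact mul_neg_of_neg_of_pos (sub_neg.2 (ht h2)) (sub_pos.2 (ht h1))
  have hpos : ∀ x : Fin n, (a < x ∧ b < x) ∨ (x < a ∧ x < b) →
      0 < (t x - t a) * (t x - t b) := by
    rintro x (⟨h1, h2⟩ | ⟨h1, h2⟩)
    · exact mul_pos (sub_pos.2 (ht h1)) (sub_pos.2 (ht h2))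
    · exact mul_pos_of_neg_of_neg (sub_neg.2 (ht h1)) (sub_neg.2 (ht h2))
  have hQ : ((t c - t a) * (t c - t b)) * ((t e - t a) * (t e - t b)) < 0 := by
    have : (((a < c ∧ c < b) ∨ (b < c ∧ c < a)) ∧ ((a < e ∧ b < e) ∨ (e < a ∧ e < b))) ∨
        (((a < c ∧ b < c) ∨ (c < a ∧ c < b)) ∧ ((a < e ∧ e < b) ∨ (b < e ∧ e < a))) := by
      clear hneg hpos h ht
      simp only [CyclicOrder, not_or] at hcon
      obtain ⟨k1, k2, k3, k4⟩ := hcon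
      grind
    rcases this with ⟨h1, h2⟩ | ⟨h1, h2⟩
    · exact mul_neg_of_neg_of_pos (hneg c h1) (hpos e h2)
    · exact mul_neg_of_pos_of_neg (hpos c h1) (hneg e h2)
  have h1 : 0 < (t b - t a) ^ 2 := by
    have := sub_ne_zero.2 (ht.injective.ne hab.symm)
    positivity
  have h2 : 0 < (t e - t c) ^ 2 := by
    have := sub_ne_zero.2 (ht.injective.ne hce.symm)
    positivity
  constructor
  · rw [orient_parabola, orient_parabola]
    have := mul_neg_of_pos_of_neg h1 hQ
    linarith
  · rw [orient_parabola, orient_parabola]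
    have := mul_neg_of_pos_of_neg h2 hQ
    linarith

theorem eq_of_insert_eq_of_lt {p q r p' q' r' : ℕ} (h1 : p < q) (h2 : q < r) (h1' : p' < q')
    (h2' : q' < r') (h : ({p, q, r} : Finset ℕ) = {p', q', r'}) : p = p' ∧ q = q' ∧ r = r' := by
  have k : ∀ x, (x = p ∨ x = q ∨ x = r) ↔ (x = p' ∨ x = q' ∨ x = r') := fun x => by
    simpa using Finset.ext_iff.1 h x
  have := k p
  have := k q
  have := k r
  have := k p'
  have := k q'
  have := k r'
  omega

theorem sum_cyclicOrder_le {n d s : ℕ} (hn : n + 1 = d + 2 * s) (a : Fin n) :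
    ∑ b, ∑ c, ∑ e, ind ((antipodalGraph n s).Adj a b ∧ (antipodalGraph n s).Adj c e ∧
      CyclicOrder a b c e) ≤ d.choose 3 := by
  classical
  have h : ∑ b, ∑ c, ∑ e, ind ((antipodalGraph n s).Adj a b ∧ (antipodalGraph n s).Adj c e ∧
      CyclicOrder a b c e) = ∑ x : Fin n × Fin n × Fin n, ind ((antipodalGraph n s).Adj a x.1 ∧
        (antipodalGraph n s).Adj x.2.1 x.2.2 ∧ CyclicOrder a x.1 x.2.1 x.2.2) := by
    simp only [Fintype.sum_prod_type]
  rw [h, sum_ind, Nat.cast_le, ← Finset.card_range d, ← Finset.card_powersetCard]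
  -- Forward cyclic distance from a.
  let g : Fin n → ℕ := fun b => if a ≤ b then b.val - a else b.val + n - a
  have hlt : ∀ x : Fin n × Fin n × Fin n, ((antipodalGraph n s).Adj a x.1 ∧
        (antipodalGraph n s).Adj x.2.1 x.2.2 ∧ CyclicOrder a x.1 x.2.1 x.2.2) →
      s ≤ g x.1 ∧ g x.1 < g x.2.1 ∧ g x.2.1 + s ≤ g x.2.2 ∧ g x.2.2 < n := by
    rintro ⟨b, c, e⟩ ⟨h1, h2, h3⟩
    simp only [antipodalGraph_adj, CyclicOrder, Fin.lt_def] at h1 h2 h3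
    simp only [g, Fin.le_def]
    split_ifs <;> omega
  have hg : ∀ b c, g b = g c → b = c := by
    intro b c h
    simp only [g, Fin.le_def] at h
    apply Fin.ext
    split_ifs at h <;> omega
  -- From s ≤ g b < g c, g c + s ≤ g e and g e < n, the three entries are strictly increasing and
  -- lie below n + 1 − 2s = d. The + 1 turns the weak inequality g c + s ≤ g e into a strict one.
  refine Finset.card_le_card_of_injOn
    (fun x => {g x.1 - s, g x.2.1 - s, g x.2.2 + 1 - 2 * s}) ?_ ?_
  · intro x hx
    have := hlt x (by simpa using hx)
    simp only [Finset.mem_coe,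
      Finset.mem_powersetCard]
    refine ⟨?_, ?_⟩
    · intro k hk
      simp only [Finset.mem_insert, Finset.mem_singleton] at hk
      rw [Finset.mem_range]
      omega
    · rw [Finset.card_eq_three]
      exact ⟨_, _, _, by omega, by omega, by omega, rfl⟩
  · intro x hx y hy hxy
    have h1 := hlt x (by simpa using hx)
    have h2 := hlt y (by simpa using hy)
    obtain ⟨e1, e2, e3⟩ := eq_of_insert_eq_of_lt (by omega) (by omega) (by omega) (by omega) hxy
    exact Prod.ext (hg _ _ (by omega)) (Prod.ext (hg _ _ (by omega)) (hg _ _ (by omega)))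

theorem six_mul_choose_three (d : ℕ) : 6 * (d.choose 3 : ℤ) = d * (d - 1) * (d - 2) := by
  have h2 : ∀ d : ℕ, 2 * (d.choose 2 : ℤ) = d * (d - 1) := by
    intro d
    induction d with
    | zero => simp
    | succ d ih =>
      rw [Nat.choose_succ_succ' d 1]
      push_cast [Nat.choose_one_right]
      linarith
  induction d with
  | zero => simp
  | succ d ih =>
    rw [Nat.choose_succ_succ' d 2]
    push_cast
    linarith [h2 d]

/-- Every disjoint non-crossing pair is cyclically ordered in at least one of its four labellings,
so there are at most 4n·C(d, 3) such pairs, which is the deficit allowed by the upper bound. -/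
theorem le_three_mul_sum_properCross_antipodalGraph {n d s : ℕ} (hs : 1 ≤ s)
    (hn : n + 1 = d + 2 * s) {t : Fin n → ℝ} (ht : StrictMono t) :
    (n : ℤ) * d * (3 * n * d - 2 * (d : ℤ) ^ 2 - 6 * d + 2) ≤
    3 * ∑ a, ∑ b, ∑ c, ∑ e, ind ((antipodalGraph n s).Adj a b) *
      ind ((antipodalGraph n s).Adj c e) * ind (ProperCross (parabola t) a b c e) := by
  set G := antipodalGraph n s with hG
  have hT := sum_disjoint_darts (G := G) (d := d) (sum_antipodalGraph_adj hs hn)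
  rw [Fintype.card_fin] at hT
  set F : Fin n → Fin n → Fin n → Fin n → ℤ := fun a b c e =>
    ind (G.Adj a b ∧ G.Adj c e ∧ CyclicOrder a b c e) with hF
  have hK : ∑ a, ∑ b, ∑ c, ∑ e, F a b c e ≤ n * d.choose 3 := by
    calc _ ≤ ∑ _a : Fin n, (d.choose 3 : ℤ) :=
          Finset.sum_le_sum fun a _ => sum_cyclicOrder_le hn a
      _ = _ := by simp
  have hN : ∑ a, ∑ b, ∑ c, ∑ e, ind (G.Adj a b) * ind (G.Adj c e) *
      ((1 - ind (a = c)) * (1 - ind (a = e)) * ((1 - ind (b = c)) * (1 - ind (b = e)))) -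
      ∑ a, ∑ b, ∑ c, ∑ e, ind (G.Adj a b) * ind (G.Adj c e) *
        ind (ProperCross (parabola t) a b c e) ≤
      ∑ a, ∑ b, ∑ c, ∑ e, (F a b c e + F b a c e + F a b e c + F b a e c) := by
    simp only [← Finset.sum_sub_distrib]
    refine Finset.sum_le_sum fun a _ => Finset.sum_le_sum fun b _ => Finset.sum_le_sum fun c _ =>
      Finset.sum_le_sum fun e _ => ?_
    have hnn : ∀ a b c e, 0 ≤ F a b c e := fun a b c e => ind_nonneg _
    have n1 := hnn a b c e
    have n2 := hnn b a c e
    have n3 := hnn a b e c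
    have n4 := hnn b a e c
    by_cases h : G.Adj a b ∧ G.Adj c e
    · obtain ⟨h1, h2⟩ := h
      rw [ind_true h1, ind_true h2]
      by_cases hx : ProperCross (parabola t) a b c e
      · obtain ⟨m1, m2, m3, m4⟩ := hx.ne
        rw [ind_true hx, ind_false m1, ind_false m2, ind_false m3, ind_false m4]
        linarith
      · rw [ind_false hx]
        by_cases hne : a ≠ c ∧ a ≠ e ∧ b ≠ c ∧ b ≠ e
        · obtain ⟨m1, m2, m3, m4⟩ := hne
          rw [ind_false m1, ind_false m2, ind_false m3, ind_false m4]
          rcases cyclicOrder_of_not_properCross ht h1.ne m1 m2 m3 m4 h2.ne hx with k | k | k | k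
          · have : F a b c e = 1 := ind_true ⟨h1, h2, k⟩
            linarith
          · have : F b a c e = 1 := ind_true ⟨h1.symm, h2, k⟩
            linarith
          · have : F a b e c = 1 := ind_true ⟨h1, h2.symm, k⟩
            linarith
          · have : F b a e c = 1 := ind_true ⟨h1.symm, h2.symm, k⟩
            linarith
        · have h0 : (1 - ind (a = c)) * (1 - ind (a = e)) *
              ((1 - ind (b = c)) * (1 - ind (b = e))) = 0 := by
            simp only [ind]; grind
          rw [h0]
          linarith
    · have h0 : ind (G.Adj a b) * ind (G.Adj c e) = 0 := by
        simp only [ind]; grind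
      rw [h0]
      linarith
  rw [← four_mul_sum_eq F, hT] at hN
  have := six_mul_choose_three d
  nlinarith

/-! ### Transfer to crossing numbers and conclusion -/

theorem RectilinearDrawing.eight_mul_numCrossings_eq_sum {V : Type*} [Fintype V]
    {G : SimpleGraph V} (D : RectilinearDrawing G) :
    (8 * D.numCrossings : ℤ) = ∑ a, ∑ b, ∑ c, ∑ e,
      ind (G.Adj a b) * ind (G.Adj c e) * ind (ProperCross D.pos a b c e) := by
  classical
  have h : ∀ a b c e, ind (G.Adj a b) * ind (G.Adj c e) * ind (ProperCross D.pos a b c e) =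
      ind (G.Adj a b ∧ G.Adj c e ∧ ProperCross D.pos a b c e) := by
    intro a b c e
    simp only [ind]
    grind
  have h' := D.eight_mul_numCrossings
  rw [← Nat.cast_inj (R := ℤ), ← sum_ind] at h'
  simp only [h]
  simpa [Fintype.sum_prod_type] using h'

theorem sum_ind_adj_of_mem_regularGraphs {n d : ℕ} {G : SimpleGraph (Fin n)}
    (hG : G ∈ regularGraphs n d) (u : Fin n) : ∑ v, ind (G.Adj u v) = d := by
  classical
  have h : G.degree u = d := by
    have := hG u
    convert this
  rw [sum_ind, ← h, ← SimpleGraph.card_neighborFinset_eq_degree,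
    SimpleGraph.neighborFinset_eq_filter]

theorem antipodalGraph_mem_regularGraphs {n d s : ℕ} (hs : 1 ≤ s) (hn : n + 1 = d + 2 * s) :
    antipodalGraph n s ∈ regularGraphs n d := by
  classical
  intro u
  rw [← card_filter_antipodalGraph_adj hs hn u, ← SimpleGraph.card_neighborFinset_eq_degree,
    SimpleGraph.neighborFinset_eq_filter]

theorem RectilinearDrawing.numCrossings_le_of_regular {n d : ℕ} {G : SimpleGraph (Fin n)}
    (hG : G ∈ regularGraphs n d) (D : RectilinearDrawing G) :
    24 * (D.numCrossings : ℤ) ≤ n * d * (3 * n * d - 2 * (d : ℤ) ^ 2 - 6 * d + 2) := by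
  obtain ⟨pos, hpos, hcross⟩ := exists_general_position D.pos
  have h := three_mul_sum_properCross_le (sum_ind_adj_of_mem_regularGraphs hG) hpos
  rw [Fintype.card_fin] at h
  have hle : (8 * D.numCrossings : ℤ) ≤ ∑ a, ∑ b, ∑ c, ∑ e,
      ind (G.Adj a b) * ind (G.Adj c e) * ind (ProperCross pos a b c e) := by
    rw [D.eight_mul_numCrossings_eq_sum]
    refine Finset.sum_le_sum fun a _ => Finset.sum_le_sum fun b _ => Finset.sum_le_sum fun c _ =>
      Finset.sum_le_sum fun e _ => mul_le_mul_of_nonneg_left ?_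
        (mul_nonneg (ind_nonneg _) (ind_nonneg _))
    by_cases hx : ProperCross D.pos a b c e
    · rw [ind_true hx, ind_true (hcross _ _ _ _ hx)]
    · rw [ind_false hx]
      exact ind_nonneg _
  linarith

/-- On ℕ, `sSup` is a true maximum only for nonempty bounded sets and defaults to 0 otherwise. The
parabola drawing gives nonemptiness, and the upper bound gives boundedness. -/
theorem isGreatest_maxRectilinearCrossingNumber {n d : ℕ} {G : SimpleGraph (Fin n)}
    (hG : G ∈ regularGraphs n d) :
    IsGreatest (rectilinearCrossingCounts G) (maxRectilinearCrossingNumber G) := by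
  obtain ⟨t, ht, hg⟩ := exists_strictMono_chordGeneric n
  have hne : (rectilinearCrossingCounts G).Nonempty :=
    ⟨_, parabolaDrawing G ht.injective hg, rfl⟩
  have hbdd : BddAbove (rectilinearCrossingCounts G) := by
    refine ⟨(n * d * (3 * n * d - 2 * (d : ℤ) ^ 2 - 6 * d + 2)).toNat, ?_⟩
    rintro _ ⟨D, rfl⟩
    have := D.numCrossings_le_of_regular hG
    simp only
    omega
  exact ⟨Nat.sSup_mem hne hbdd, fun m hm => le_csSup hbdd hm⟩

theorem theorem3p1 (n d : ℕ) (hdn : d < n) (hodd : Odd (n + d)) :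
    (∀ G ∈ regularGraphs n d,
      IsGreatest (rectilinearCrossingCounts G) (maxRectilinearCrossingNumber G)) ∧
    IsGreatest (maxRectilinearCrossingNumber '' regularGraphs n d)
      (maxRectilinearCrossingNumberRegular n d) ∧
    (maxRectilinearCrossingNumberRegular n d : ℚ) =
      (n : ℚ) * d * (3 * n * d - 2 * (d : ℚ) ^ 2 - 6 * d + 2) / 24 := by
  -- Parity of n + d makes n + 1 − d even, and d < n makes the half at least 1.
  obtain ⟨s, hs, hn⟩ : ∃ s, 1 ≤ s ∧ n + 1 = d + 2 * s := by
    obtain ⟨k, hk⟩ := hodd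
    exact ⟨(n + 1 - d) / 2, by omega, by omega⟩
  have hmem := antipodalGraph_mem_regularGraphs hs hn
  have hle : ∀ G ∈ regularGraphs n d, 24 * (maxRectilinearCrossingNumber G : ℤ) ≤
      n * d * (3 * n * d - 2 * (d : ℤ) ^ 2 - 6 * d + 2) := by
    intro G hG
    obtain ⟨D, hD⟩ := (isGreatest_maxRectilinearCrossingNumber hG).1
    rw [← hD]
    exact D.numCrossings_le_of_regular hG
  have hbdd : BddAbove (maxRectilinearCrossingNumber '' regularGraphs n d) := by
    refine ⟨(n * d * (3 * n * d - 2 * (d : ℤ) ^ 2 - 6 * d + 2)).toNat, ?_⟩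
    rintro _ ⟨G, hG, rfl⟩
    have := hle G hG
    omega
  have hgreat : IsGreatest (maxRectilinearCrossingNumber '' regularGraphs n d)
      (maxRectilinearCrossingNumberRegular n d) :=
    ⟨Nat.sSup_mem ⟨_, _, hmem, rfl⟩ hbdd, fun m hm => le_csSup hbdd hm⟩
  refine ⟨fun G hG => isGreatest_maxRectilinearCrossingNumber hG, hgreat, ?_⟩
  have hub : 24 * (maxRectilinearCrossingNumberRegular n d : ℤ) ≤
      n * d * (3 * n * d - 2 * (d : ℤ) ^ 2 - 6 * d + 2) := by
    obtain ⟨G, hG, h⟩ := hgreat.1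
    rw [← h]
    exact hle G hG
  have hlb : (n * d * (3 * n * d - 2 * (d : ℤ) ^ 2 - 6 * d + 2) : ℤ) ≤
      24 * (maxRectilinearCrossingNumberRegular n d : ℤ) := by
    obtain ⟨t, ht, hg⟩ := exists_strictMono_chordGeneric n
    let D := parabolaDrawing (antipodalGraph n s) ht.injective hg
    have h1 := le_three_mul_sum_properCross_antipodalGraph hs hn ht
    have h2 : (8 * D.numCrossings : ℤ) = _ := D.eight_mul_numCrossings_eq_sum
    have h3 : D.numCrossings ≤ maxRectilinearCrossingNumberRegular n d :=
      ((isGreatest_maxRectilinearCrossingNumber hmem).2 ⟨D, rfl⟩).trans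
        (hgreat.2 ⟨_, hmem, rfl⟩)
    change _ ≤ 3 * ∑ a, ∑ b, ∑ c, ∑ e, ind ((antipodalGraph n s).Adj a b) *
      ind ((antipodalGraph n s).Adj c e) * ind (ProperCross D.pos a b c e) at h1
    rw [← h2] at h1
    omega
  have heq : (24 * maxRectilinearCrossingNumberRegular n d : ℚ) =
      n * d * (3 * n * d - 2 * (d : ℚ) ^ 2 - 6 * d + 2) := by
    exact_mod_cast le_antisymm hub hlb
  linarith
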